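/- Let $\Omega$ be a completely regular Hausdorff space and let $\mathrm{C}_{\mathrm b}(\Omega)$ be the Banach space of bounded continuous functions $f\colon\Omega\to\mathbb{K}$, $\mathbb{K}\in\{\mathbb{R},\mathbb{C}\}$, with the norm $\|f\|_\infty=\sup_{x\in\Omega}|f(x)|$. Let $\tau_{\mathrm{co}}$ be the compact-open topology on $\mathrm{C}_{\mathrm b}(\Omega)$, generated by the seminorms $p_K(f)=\sup_{x\in K}|f(x)|$, $K\subset\Omega$ compact. Let $\beta_0$ be the locally convex topology on $\mathrm{C}_{\mathrm b}(\Omega)$ generated by the seminorms $|f|_\nu=\sup_{x\in\Omega}|f(x)|\nu(x)$, where $\nu$ ranges over the bounded functions $\nu\colon\Omega\to[0,\infty)$ such that $\{x\in\Omega : \nu(x)\ge\varepsilon\}$ is compact for every $\varepsilon>0$. Let $\phi\colon[0,\infty)\times\Omega\to\Omega$, $\phi(t,x)=\phi_t(x)$, be a semiflow, i.e. $\phi_0=\mathrm{id}$ and $\phi_t\phi_s=\phi_{t+s}$ for all $t,s\ge 0$. Consider the Koopman semigroup $(T_\phi(t))_{t\ge0}$ on $\mathrm{C}_{\mathrm b}(\Omega)$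 given by $T_\phi(t)f=f\circ\phi_t$; it is well defined if $f\circ\phi_t$ is continuous for all $t\ge 0$ and $f\in \mathrm{C}_{\mathrm b}(\Omega)$, which is the case if $\phi$ is (jointly) continuous, and which is understood as part of the hypothesis in (b). Terminology. Let $X=\mathrm{C}_{\mathrm b}(\Omega)$, $\|\cdot\|=\|\cdot\|_\infty$ and let $\tau$ be a Hausdorff locally convex topology on $X$. A semigroup $(T(t))_{t\ge0}$ of linear maps on $X$ is *$\tau$-strongly continuous* if $t\mapsto T(t)f$ is $\tau$-continuous on $[0,\infty)$ for every $f\in X$. A family $(S(t))_{t\in I}$ of linear maps on $X$ is *$\tau$-equicontinuous* if for every $f\in X$ and every $\tau$-neighbourhood $U$ of zero there is a $\tau$-neighbourhood $V$ of $f$ with $S(t)(V)\subset S(t)f+U$ for all $t\in I$. It is *$(\|\cdot\|_\infty,\tau_{\mathrm{co}})$-equitight* if for every $\varepsilon>0$ and every compact $K\subset\Omega$ there are a compact $\widetilde K\subset\Omega$ and $C\ge0$ such that $p_K(S(t)f)\le C\,p_{\widetilde K}(f)+\varepsilon\|f\|_\infty$ for all $t\in I$, $f\in X$. Each of these two properties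 holds *locally* for $(T(t))_{t\ge0}$ if it holds for $(T(t))_{t\in[0,t_0]}$ for all $t_0\ge0$, and it is said to hold in the *quasi-* sense if there is $\alpha\in\mathbb{R}$ such that it holds for $(e^{-\alpha t}T(t))_{t\ge0}$. $(T(t))_{t\ge0}$ is a *$\tau$-bi-continuous semigroup* if $\tau$ is coarser than the norm topology, every norm bounded $\tau$-Cauchy sequence in $X$ is $\tau$-convergent, $\|f\|=\sup\{|y(f)| : y\in(X,\tau)',\ |y(g)|\le\|g\|\ \forall g\in X\}$ for all $f\in X$, and: every $T(t)$ is norm continuous; $T(0)=\mathrm{id}$ and $T(t+s)=T(t)T(s)$ for all $t,s\geq 0$; $(T(t))_{t\ge0}$ is $\tau$-strongly continuous; there are $M\ge1$, $\omega\in\mathbb{R}$ with $\|T(t)\|\le Me^{\omega t}$ for all $t\ge0$; and for every norm bounded sequence $(f_n)$ that $\tau$-converges to some $f\in X$, $T(t)(f_n-f)\to0$ in $\tau$ uniformly in $t\in[0,t_0]$ for every $t_0\ge0$. $\Omega$ is a *$k_{\mathbb{R}}$-space* if every function $\Omega\to\mathbb{R}$ whose restriction to each compact subset of $\Omega$ is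 continuous is continuous on $\Omega$. It is *hemicompact* if there is a sequence $(K_n)_{n\in\mathbb{N}}$ of compact subsets of $\Omega$ such that every compact subset of $\Omega$ is contained in some $K_N$. (a) If $\phi$ is (jointly) continuous, then $(T_\phi(t))_{t\ge0}$ is $\beta_0$-strongly continuous, locally $\beta_0$-equicontinuous and locally $(\|\cdot\|_\infty,\tau_{\mathrm{co}})$-equitight. (b) If $\Omega$ is a $k_{\mathbb{R}}$-space and $(T_\phi(t))_{t\ge0}$ is $\beta_0$-strongly continuous, then $\phi$ is (jointly) continuous. (c) If $\Omega$ is a $k_{\mathbb{R}}$-space and $\phi$ is (jointly) continuous, then $(T_\phi(t))_{t\ge0}$ is a $\tau_{\mathrm{co}}$-bi-continuous semigroup. (d) If $\Omega$ is a hemicompact $k_{\mathbb{R}}$-space or a Polish space, and $\phi$ is (jointly) continuous, then $(T_\phi(t))_{t\ge0}$ is quasi-$\beta_0$-equicontinuous and quasi-$(\|\cdot\|_\infty,\tau_{\mathrm{co}})$-equitight. -/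

import Mathlib

open Topology Filter Set
open scoped NNReal BoundedContinuousFunction

namespace Koopman

/-! ### Families of maps on a normed space with a second, locally convex topology -/

section General

variable {X : Type*}

/-- Equicontinuity, for a vector space topology `τ`, of a family of maps `X → X`: at every `x`, for
every `τ`-neighbourhood `U` of zero there is a `τ`-neighbourhood `V` of `x` such that
`T i '' V ⊆ T i x + U` for all `i`. -/
def IsEquicontinuous [AddCommGroup X] (τ : TopologicalSpace X) {I : Type*} (T : I → X → X) : Prop :=
  ∀ x : X, ∀ U ∈ @nhds X τ 0, ∃ V ∈ @nhds X τ x, ∀ i : I, ∀ y ∈ V, T i y - T i x ∈ U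

/-- The orbits `t ↦ T t x`, `t ∈ [0, ∞)`, are continuous for the topology `τ`. -/
def IsStronglyContinuous {𝕜 : Type*} [RCLike 𝕜] [AddCommGroup X] [Module 𝕜 X]
    (τ : TopologicalSpace X) (T : ℝ≥0 → X →ₗ[𝕜] X) : Prop :=
  ∀ x : X, @Continuous ℝ≥0 X _ τ (fun t => T t x)

/-- `(T t)_{t ∈ [0, t₀]}` is `τ`-equicontinuous for all `t₀ ≥ 0`. -/
def IsLocallyEquicontinuous {𝕜 : Type*} [RCLike 𝕜] [AddCommGroup X] [Module 𝕜 X]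
    (τ : TopologicalSpace X) (T : ℝ≥0 → X →ₗ[𝕜] X) : Prop :=
  ∀ t₀ : ℝ≥0, IsEquicontinuous τ (fun (t : Icc 0 t₀) (x : X) => T t x)

/-- `(e^{-α t} T t)_{t ≥ 0}`. -/
noncomputable def rescale {𝕜 : Type*} [RCLike 𝕜] [AddCommGroup X] [Module 𝕜 X]
    (α : ℝ) (T : ℝ≥0 → X →ₗ[𝕜] X) (t : ℝ≥0) : X →ₗ[𝕜] X :=
  ((Real.exp (-α * (t : ℝ)) : ℝ) : 𝕜) • T t

/-- `(e^{-α t} T t)_{t ≥ 0}` is `τ`-equicontinuous for some real `α`. -/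
def IsQuasiEquicontinuous {𝕜 : Type*} [RCLike 𝕜] [AddCommGroup X] [Module 𝕜 X]
    (τ : TopologicalSpace X) (T : ℝ≥0 → X →ₗ[𝕜] X) : Prop :=
  ∃ α : ℝ, IsEquicontinuous τ (fun (t : ℝ≥0) (x : X) => rescale α T t x)

variable {𝕜 : Type*} [RCLike 𝕜] [NormedAddCommGroup X] [NormedSpace 𝕜 X]

/-- `(‖·‖, τ)`-equitightness of a family of linear maps, where `P` is a directed system of seminorms
generating `τ`. -/
def IsEquitight {ι : Type*} (P : SeminormFamily 𝕜 X ι) {I : Type*} (T : I → X →ₗ[𝕜] X) : Prop :=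
  ∀ ε : ℝ, 0 < ε → ∀ i : ι, ∃ j : ι, ∃ C : ℝ, 0 ≤ C ∧
    ∀ (t : I) (x : X), P i (T t x) ≤ C * P j x + ε * ‖x‖

/-- `(T t)_{t ∈ [0, t₀]}` is equitight for all `t₀ ≥ 0`. -/
def IsLocallyEquitight {ι : Type*} (P : SeminormFamily 𝕜 X ι) (T : ℝ≥0 → X →ₗ[𝕜] X) : Prop :=
  ∀ t₀ : ℝ≥0, IsEquitight P (fun t : Icc 0 t₀ => T t)

/-- `(e^{-α t} T t)_{t ≥ 0}` is equitight for some real `α`. -/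
def IsQuasiEquitight {ι : Type*} (P : SeminormFamily 𝕜 X ι) (T : ℝ≥0 → X →ₗ[𝕜] X) : Prop :=
  ∃ α : ℝ, IsEquitight P (fun t : ℝ≥0 => rescale α T t)

variable (X) in
/-- The topology of the norm. -/
abbrev normTopology : TopologicalSpace X := PseudoMetricSpace.toUniformSpace.toTopologicalSpace

variable (𝕜) in
/-- The standing assumptions on a triple `(X, ‖·‖, τ)` under which bi-continuous semigroups are
considered. -/
structure IsBiContinuousTriple (τ : TopologicalSpace X) : Prop where
  /-- `(X, ‖·‖)` is a Banach space. -/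
  complete : CompleteSpace X
  /-- `τ` is coarser than the norm topology (in Mathlib's order, finer topologies are smaller). -/
  coarser : normTopology X ≤ τ
  hausdorff : @T2Space X τ
  /-- `τ` is a locally convex topology, that is, it is generated by seminorms. -/
  locallyConvex : @PolynormableSpace 𝕜 X _ _ _ τ
  /-- Every norm bounded `τ`-Cauchy sequence is `τ`-convergent. -/
  seqComplete : ∀ x : ℕ → X, (∃ C : ℝ, ∀ n, ‖x n‖ ≤ C) →
    (∀ U ∈ @nhds X τ 0, ∃ N : ℕ, ∀ m ≥ N, ∀ n ≥ N, x m - x n ∈ U) →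
    ∃ y : X, Tendsto x atTop (@nhds X τ y)
  /-- The topological dual of `(X, τ)` is norming: `‖x‖` is the supremum of `|y x|` over all
  `τ`-continuous linear functionals `y` of norm at most one. -/
  norming : ∀ x : X,
    IsLUB {r : ℝ | ∃ y : X →ₗ[𝕜] 𝕜, @Continuous X 𝕜 τ _ y ∧ (∀ z, ‖y z‖ ≤ ‖z‖) ∧ r = ‖y x‖} ‖x‖

/-- A `τ`-bi-continuous semigroup on `(X, ‖·‖, τ)`. -/
structure IsBiContinuousSemigroup (τ : TopologicalSpace X) (T : ℝ≥0 → X →ₗ[𝕜] X) : Prop where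
  triple : IsBiContinuousTriple 𝕜 τ
  /-- Each `T t` is a bounded operator for the norm. -/
  bounded : ∀ t, ∃ C : ℝ, ∀ x : X, ‖T t x‖ ≤ C * ‖x‖
  map_zero : T 0 = LinearMap.id
  map_add : ∀ t s, T (t + s) = T t ∘ₗ T s
  stronglyContinuous : IsStronglyContinuous τ T
  /-- `‖T t‖ ≤ M e^{ω t}` for all `t ≥ 0`. -/
  expBounded : ∃ M : ℝ, 1 ≤ M ∧ ∃ ω : ℝ, ∀ (t : ℝ≥0) (x : X),
    ‖T t x‖ ≤ M * Real.exp (ω * (t : ℝ)) * ‖x‖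
  /-- For norm bounded sequences `xₙ → x` in `τ`, one has `T t (xₙ - x) → 0` in `τ`, locally
  uniformly in `t ∈ [0, ∞)`. -/
  biEquicontinuous : ∀ (x : ℕ → X) (y : X), (∃ C : ℝ, ∀ n, ‖x n‖ ≤ C) →
    Tendsto x atTop (@nhds X τ y) →
    ∀ t₀ : ℝ≥0, ∀ U ∈ @nhds X τ 0, ∀ᶠ n in atTop, ∀ t ≤ t₀, T t (x n - y) ∈ U

end General

/-! ### The spaces `Ω` -/

/-- A `k_ℝ`-space: a completely regular space on which every real-valued function whose restriction
to each compact set is continuous is itself continuous. -/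
def IsKRSpace (Ω : Type*) [TopologicalSpace Ω] : Prop :=
  CompletelyRegularSpace Ω ∧
    ∀ f : Ω → ℝ, (∀ K : Set Ω, IsCompact K → ContinuousOn f K) → Continuous f

/-- A hemicompact space: some sequence of compact sets is cofinal among all compact sets. -/
def IsHemicompact (Ω : Type*) [TopologicalSpace Ω] : Prop :=
  ∃ K : ℕ → Set Ω, (∀ n, IsCompact (K n)) ∧ ∀ L : Set Ω, IsCompact L → ∃ N, L ⊆ K N

/-! ### The topologies on `C_b(Ω)` -/

section Topologies

variable (𝕜 : Type*) [RCLike 𝕜] (Ω : Type*) [TopologicalSpace Ω]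

variable {Ω} in
/-- Non-negative bounded functions `ν` on `Ω`, not necessarily continuous, which vanish at infinity
in the sense that `{x | ε ≤ ν x}` is compact for every `ε > 0`. -/
structure IsWeight (ν : Ω → ℝ) : Prop where
  nonneg : ∀ x, 0 ≤ ν x
  bounded : ∃ C : ℝ, ∀ x, ν x ≤ C
  compact : ∀ ε : ℝ, 0 < ε → IsCompact {x | ε ≤ ν x}

variable {𝕜 Ω} in
theorem IsWeight.bddAbove {ν : Ω → ℝ} (hν : IsWeight ν) (f : Ω →ᵇ 𝕜) :
    BddAbove (range fun x => ‖f x‖ * ν x) := by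
  obtain ⟨C, hC⟩ := hν.bounded
  refine ⟨‖f‖ * C, ?_⟩
  rintro _ ⟨x, rfl⟩
  exact mul_le_mul (f.norm_coe_le_norm x) (hC x) (hν.nonneg x) (norm_nonneg _)

variable {𝕜 Ω} in
theorem bddAbove_norm (S : Set Ω) (f : Ω →ᵇ 𝕜) : BddAbove (range fun x : S => ‖f x‖) := by
  refine ⟨‖f‖, ?_⟩
  rintro _ ⟨x, rfl⟩
  exact f.norm_coe_le_norm x

variable {Ω} in
/-- The seminorm `|f|_ν = sup_{x ∈ Ω} |f x| ν x`. -/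
noncomputable def weightSeminorm {ν : Ω → ℝ} (hν : IsWeight ν) : Seminorm 𝕜 (Ω →ᵇ 𝕜) :=
  Seminorm.of (fun f => ⨆ x, ‖f x‖ * ν x)
    (by
      intro f g
      rcases isEmpty_or_nonempty Ω with h | h
      · simp
      refine ciSup_le fun x => ?_
      have h1 := le_ciSup (hν.bddAbove f) x
      have h2 := le_ciSup (hν.bddAbove g) x
      have h3 : ‖(f + g) x‖ * ν x ≤ (‖f x‖ + ‖g x‖) * ν x :=
        mul_le_mul_of_nonneg_right (norm_add_le _ _) (hν.nonneg x)
      rw [add_mul] at h3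
      exact h3.trans (add_le_add h1 h2))
    (by
      intro a f
      rw [Real.mul_iSup_of_nonneg (norm_nonneg a)]
      simp [mul_assoc])

variable {Ω} in
/-- The seminorm `p_K f = sup_{x ∈ K} |f x|`. -/
noncomputable def supSeminorm (S : Set Ω) : Seminorm 𝕜 (Ω →ᵇ 𝕜) :=
  Seminorm.of (fun f => ⨆ x : S, ‖f x‖)
    (by
      intro f g
      rcases isEmpty_or_nonempty S with h | h
      · simp
      refine ciSup_le fun x => ?_
      exact (norm_add_le _ _).trans
        (add_le_add (le_ciSup (bddAbove_norm S f) x) (le_ciSup (bddAbove_norm S g) x)))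
    (by
      intro a f
      rw [Real.mul_iSup_of_nonneg (norm_nonneg a)]
      simp)

theorem isWeight_zero : IsWeight (fun _ : Ω => (0 : ℝ)) where
  nonneg _ := le_rfl
  bounded := ⟨0, fun _ => le_rfl⟩
  compact ε hε := by simp [not_le.mpr hε]

instance instNonemptyWeight : Nonempty {ν : Ω → ℝ // IsWeight ν} := ⟨⟨_, isWeight_zero Ω⟩⟩

/-- The seminorms `|·|_ν`, for all weights `ν`. -/
noncomputable def strictSeminorms : SeminormFamily 𝕜 (Ω →ᵇ 𝕜) {ν : Ω → ℝ // IsWeight ν} :=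
  fun ν => weightSeminorm 𝕜 ν.2

/-- The strict topology `β₀` on `C_b(Ω)`, induced by the seminorms `|·|_ν`. -/
noncomputable abbrev strictTopology : TopologicalSpace (Ω →ᵇ 𝕜) :=
  (strictSeminorms 𝕜 Ω).moduleFilterBasis.topology

/-- The directed system of seminorms `p_K`, for all compact `K ⊆ Ω`. -/
noncomputable def compactSeminorms : SeminormFamily 𝕜 (Ω →ᵇ 𝕜) (TopologicalSpace.Compacts Ω) :=
  fun K => supSeminorm 𝕜 (K : Set Ω)

/-- The compact-open topology `τ_co` on `C_b(Ω)`. -/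
abbrev compactOpenTopology : TopologicalSpace (Ω →ᵇ 𝕜) :=
  TopologicalSpace.induced (fun f => f.toContinuousMap) ContinuousMap.compactOpen

/-- The system `(p_K)_K` is directed. -/
theorem directed_compactSeminorms : Directed (· ≤ ·) (compactSeminorms 𝕜 Ω) := by
  have key : ∀ S T : Set Ω, S ⊆ T → supSeminorm 𝕜 S ≤ supSeminorm 𝕜 T := by
    intro S T h f
    refine Real.iSup_le (fun x => le_ciSup (bddAbove_norm T f) ⟨x, h x.2⟩) ?_
    exact Real.iSup_nonneg fun _ => norm_nonneg _
  exact fun K L => ⟨K ⊔ L, key _ _ (by simp), key _ _ (by simp)⟩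

/-- The system `(p_K)_K` generates `τ_co`. -/
theorem withSeminorms_compactSeminorms :
    @WithSeminorms 𝕜 (Ω →ᵇ 𝕜) (TopologicalSpace.Compacts Ω) _ _ _ (compactSeminorms 𝕜 Ω)
      (compactOpenTopology 𝕜 Ω) := by
  let τ : TopologicalSpace (Ω →ᵇ 𝕜) := compactOpenTopology 𝕜 Ω
  have : @IsTopologicalAddGroup (Ω →ᵇ 𝕜) τ _ :=
    topologicalAddGroup_induced
      (BoundedContinuousFunction.toContinuousMapLinearMap Ω 𝕜 𝕜)
  rw [SeminormFamily.withSeminorms_iff_nhds_eq_iInf]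
  refine eq_of_forall_le_iff fun F => ?_
  rw [nhds_induced, ← tendsto_iff_comap,
    ContinuousMap.tendsto_iff_forall_isCompact_tendstoUniformlyOn, le_iInf_iff]
  simp only [← tendsto_iff_comap]
  have key : ∀ S : Set Ω, TendstoUniformlyOn (fun (f : Ω →ᵇ 𝕜) x => f x) 0 F S ↔
      Tendsto (supSeminorm 𝕜 S) F (𝓝 0) := by
    intro S
    rw [Metric.tendstoUniformlyOn_iff, Metric.tendsto_nhds]
    constructor
    · intro h ε hε
      filter_upwards [h (ε / 2) (by positivity)] with f hf
      have h0 : 0 ≤ supSeminorm 𝕜 S f := apply_nonneg _ _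
      rw [Real.dist_eq, sub_zero, abs_of_nonneg h0]
      refine lt_of_le_of_lt (Real.iSup_le (fun x => ?_) (by positivity)) (half_lt_self hε)
      simpa using (hf x x.2).le
    · intro h ε hε
      filter_upwards [h ε hε] with f hf x hx
      have h0 : 0 ≤ supSeminorm 𝕜 S f := apply_nonneg _ _
      rw [Real.dist_eq, sub_zero, abs_of_nonneg h0] at hf
      have h1 : ‖f x‖ ≤ supSeminorm 𝕜 S f := le_ciSup (bddAbove_norm S f) ⟨x, hx⟩
      simpa using h1.trans_lt hf
  exact ⟨fun h K => (key K).1 (h K K.isCompact), fun h K hK => (key K).2 (h ⟨K, hK⟩)⟩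

end Topologies

/-! ### Semiflows and the Koopman semigroup -/

section Semiflow

variable {Ω : Type*}

/-- `φ_0 = id` and `φ_t φ_s = φ_{t+s}`. No continuity is required. -/
structure IsSemiflow (φ : ℝ≥0 → Ω → Ω) : Prop where
  map_zero : φ 0 = id
  map_add : ∀ t s, φ t ∘ φ s = φ (t + s)

variable [TopologicalSpace Ω] (𝕜 : Type*) [RCLike 𝕜]

/-- Composition with each `φ_t` maps `C_b(Ω)` into itself, so that the Koopman semigroup is a
family of operators on `C_b(Ω)`. -/
def PreservesCb (φ : ℝ≥0 → Ω → Ω) : Prop :=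
  ∀ (t : ℝ≥0) (f : Ω →ᵇ 𝕜), Continuous (fun x => f (φ t x))

theorem preservesCb_of_continuous {φ : ℝ≥0 → Ω → Ω}
    (hφ : Continuous fun p : ℝ≥0 × Ω => φ p.1 p.2) : PreservesCb 𝕜 φ := fun t f =>
  f.continuous.comp (hφ.comp (Continuous.prodMk_right t))

variable {𝕜} in
/-- The Koopman semigroup `T_φ(t) f = f ∘ φ_t` on `C_b(Ω)`. -/
noncomputable def koopman {φ : ℝ≥0 → Ω → Ω} (h : PreservesCb 𝕜 φ) (t : ℝ≥0) :
    (Ω →ᵇ 𝕜) →ₗ[𝕜] (Ω →ᵇ 𝕜) where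
  toFun f := BoundedContinuousFunction.ofNormedAddCommGroup (fun x => f (φ t x)) (h t f) ‖f‖
    (fun x => f.norm_coe_le_norm (φ t x))
  map_add' _ _ := rfl
  map_smul' _ _ := rfl

end Semiflow

end Koopman

/-! Superlevel sets of a weight are compact, hence closed in a Hausdorff space, so weights are upper
semicontinuous. Two constructions follow: a product `w t * ν x` of weights is again a weight
(`IsWeight.prod`), and a weight can be pushed forward along a continuous map by taking suprema over
fibres (`IsWeight.exists_le_comp`). Pushing `w t * ν x` forward along a continuous `φ` yields a
weight `μ` with `w t * ν x ≤ μ (φ t x)`, so `w t * |T t f|_ν ≤ |f|_μ`. The indicator of `[0, t₀]` as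
`w` gives local equicontinuity, and `exp (-t)` gives quasi-equicontinuity. Equitightness comes from
the compact image of `{ε ≤ w} × K`.

Strong continuity for `τ_co` is a tube-lemma argument; it passes to `β₀` because orbits are norm
bounded and weights are small off compact sets.

Conversely, `β₀`-continuous orbits make `(t, x) ↦ f (φ t x)` continuous over each compact `K ⊆ Ω`.
As time is locally compact, the `k_ℝ` property gives continuity on the whole product
(`IsKRSpace.continuous_prod`), and complete regularity recovers continuity of `φ`. In the
bi-continuous setting, the `k_ℝ` property makes limits that are uniform on compact sets continuous.
-/

namespace Koopman

/-! ### Weights -/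

section Weights

variable {Ω : Type*} [TopologicalSpace Ω]

/-- The product of two weights is a weight on the product space. -/
theorem IsWeight.prod {Y : Type*} [TopologicalSpace Y] [T2Space Y] [T2Space Ω] {w : Y → ℝ}
    {ν : Ω → ℝ} (hw : IsWeight w) (hν : IsWeight ν) :
    IsWeight fun p : Y × Ω => w p.1 * ν p.2 where
  nonneg p := mul_nonneg (hw.nonneg _) (hν.nonneg _)
  bounded := by
    obtain ⟨C, hC⟩ := hw.bounded
    obtain ⟨D, hD⟩ := hν.bounded
    exact ⟨C * D, fun p => mul_le_mul (hC _) (hD _) (hν.nonneg _) ((hw.nonneg p.1).trans (hC _))⟩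
  compact ε hε := by
    obtain ⟨C, hC⟩ := hw.bounded
    obtain ⟨D, hD⟩ := hν.bounded
    -- Enlarging the bounds to at least 1 makes division by them legitimate.
    have hC' : ∀ y, w y ≤ max C 1 := fun y => (hC y).trans (le_max_left _ _)
    have hD' : ∀ x, ν x ≤ max D 1 := fun x => (hD x).trans (le_max_left _ _)
    have hC0 : 0 < max C 1 := by positivity
    have hD0 : 0 < max D 1 := by positivity
    -- The superlevel set lies in a compact box, so only its closedness, i.e. upper semicontinuity
    -- of the product, needs an argument.
    refine ((hw.compact (ε / max D 1) (by positivity)).prod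
      (hν.compact (ε / max C 1) (by positivity))).of_isClosed_subset ?_ ?_
    · rw [← isOpen_compl_iff, isOpen_iff_mem_nhds]
      rintro ⟨y, x⟩ hp
      have hlt : w y * ν x < ε := not_le.mp hp
      have hlim : Tendsto (fun δ : ℝ => (w y + δ) * (ν x + δ)) (𝓝[>] 0) (𝓝 (w y * ν x)) := by
        have : Continuous fun δ : ℝ => (w y + δ) * (ν x + δ) := by fun_prop
        simpa using (this.tendsto 0).mono_left nhdsWithin_le_nhds
      -- Both factors may grow by this `δ` with their product still below `ε`; near `(y, x)` they
      -- grow by less.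
      obtain ⟨δ, hδ, hδ0⟩ := ((hlim.eventually (gt_mem_nhds hlt)).and self_mem_nhdsWithin).exists
      have hδ0 : 0 < δ := hδ0
      have hy : {z | w y + δ ≤ w z}ᶜ ∈ 𝓝 y :=
        (hw.compact _ (add_pos_of_nonneg_of_pos (hw.nonneg y) hδ0)).isClosed.isOpen_compl.mem_nhds
          (by simpa using hδ0)
      have hx : {z | ν x + δ ≤ ν z}ᶜ ∈ 𝓝 x :=
        (hν.compact _ (add_pos_of_nonneg_of_pos (hν.nonneg x) hδ0)).isClosed.isOpen_compl.mem_nhds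
          (by simpa using hδ0)
      filter_upwards [prod_mem_nhds hy hx] with q hq
      have h1 : w q.1 < w y + δ := not_le.mp hq.1
      have h2 : ν q.2 < ν x + δ := not_le.mp hq.2
      exact not_le.mpr ((mul_le_mul h1.le h2.le (hν.nonneg _)
        ((hw.nonneg q.1).trans h1.le)).trans_lt hδ)
    · rintro ⟨y, x⟩ hp
      have hp : ε ≤ w y * ν x := hp
      exact ⟨(div_le_iff₀ hD0).mpr (hp.trans (mul_le_mul_of_nonneg_left (hD' x) (hw.nonneg y))),
        (div_le_iff₀' hC0).mpr (hp.trans (mul_le_mul_of_nonneg_right (hC' y) (hν.nonneg x)))⟩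

/-- A weight is dominated by the pullback of a weight along any continuous map into a Hausdorff
space, namely of its supremum over the fibres. -/
theorem IsWeight.exists_le_comp {Y : Type*} [TopologicalSpace Y] [T2Space Ω] {w : Y → ℝ}
    (hw : IsWeight w) {π : Y → Ω} (hπ : Continuous π) :
    ∃ μ : Ω → ℝ, IsWeight μ ∧ ∀ y, w y ≤ μ (π y) := by
  obtain ⟨C, hC⟩ := hw.bounded
  have hbdd : ∀ x, BddAbove (range fun y : {y // π y = x} => w y) := fun x =>
    ⟨C, by rintro _ ⟨y, rfl⟩; exact hC y⟩
  refine ⟨fun x => ⨆ y : {y // π y = x}, w y, ⟨fun x => Real.iSup_nonneg fun y => hw.nonneg y,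
    ⟨max C 0, fun x => Real.iSup_le (fun y => (hC y).trans (le_max_left _ _)) (le_max_right _ _)⟩,
    fun ε hε => ?_⟩, fun y => le_ciSup (hbdd (π y)) ⟨y, rfl⟩⟩
  -- The fibre supremum need not be attained a priori, hence an intersection over all `δ < ε`. Only
  -- `δ > 0` gives compact superlevel sets.
  have heq : {x | ε ≤ ⨆ y : {y // π y = x}, w y} = ⋂ δ ∈ Ioo 0 ε, π '' {y | δ ≤ w y} := by
    ext x
    simp only [mem_ofPred_eq, mem_iInter]
    constructor
    · intro h δ hδ
      -- Over an empty fibre the real supremum is 0 by convention, which is below `ε`.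
      cases isEmpty_or_nonempty {y // π y = x}
      · rw [Real.iSup_of_isEmpty] at h
        exact absurd h (not_le.mpr hε)
      · obtain ⟨y, hy⟩ := exists_lt_of_lt_ciSup (hδ.2.trans_le h)
        exact ⟨y, hy.le, y.2⟩
    · intro h
      refine le_of_forall_lt_imp_le_of_dense fun δ hδ => ?_
      rcases le_or_gt δ 0 with h0 | h0
      · exact h0.trans (Real.iSup_nonneg fun y => hw.nonneg y)
      · obtain ⟨y, hy, rfl⟩ := h δ ⟨h0, hδ⟩
        exact le_trans hy (le_ciSup (hbdd (π y)) ⟨y, rfl⟩)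
  rw [heq]
  refine ((hw.compact (ε / 2) (half_pos hε)).image hπ).of_isClosed_subset
    (isClosed_biInter fun δ hδ => ((hw.compact δ hδ.1).image hπ).isClosed)
    (biInter_subset_of_mem ⟨half_pos hε, half_lt_self hε⟩)

/-- The indicator function of a compact set is a weight. -/
theorem isWeight_indicator {K : Set Ω} (hK : IsCompact K) : IsWeight (K.indicator 1 : Ω → ℝ) where
  nonneg := indicator_nonneg fun _ _ => zero_le_one
  bounded := ⟨1, indicator_le' (fun _ _ => le_rfl) fun _ _ => zero_le_one⟩
  compact ε hε := by
    rcases le_or_gt ε 1 with h | h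
    · convert hK using 1
      ext x
      by_cases hx : x ∈ K <;> simp [hx, h, hε]
    · convert isCompact_empty using 1
      ext x
      by_cases hx : x ∈ K <;> simp [hx, h, hε]

theorem isWeight_exp_neg : IsWeight fun t : ℝ≥0 => Real.exp (-(t : ℝ)) where
  nonneg t := (Real.exp_pos _).le
  bounded := ⟨1, fun t => by simp⟩
  compact ε hε := by
    -- For `ε > 1` the truncation by `toNNReal` is harmless, since the superlevel set is then empty.
    refine (isCompact_Icc (a := 0) (b := (-Real.log ε).toNNReal)).of_isClosed_subset
      (isClosed_le (by fun_prop) (by fun_prop)) fun t ht => ⟨zero_le, ?_⟩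
    have h := (Real.le_log_iff_exp_le (Real.exp_pos _)).2 (Real.exp_log hε |>.trans_le ht)
    rw [Real.log_exp] at h
    exact NNReal.le_toNNReal_of_coe_le (by linarith)

end Weights

/-! ### The seminorms -/

section Seminorms

variable {𝕜 : Type*} [RCLike 𝕜] {Ω : Type*} [TopologicalSpace Ω]

theorem weightSeminorm_le {ν : Ω → ℝ} (hν : IsWeight ν) {f : Ω →ᵇ 𝕜} {r : ℝ} (hr : 0 ≤ r)
    (h : ∀ x, ‖f x‖ * ν x ≤ r) : weightSeminorm 𝕜 hν f ≤ r :=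
  Real.iSup_le h hr

theorem le_weightSeminorm {ν : Ω → ℝ} (hν : IsWeight ν) (f : Ω →ᵇ 𝕜) (x : Ω) :
    ‖f x‖ * ν x ≤ weightSeminorm 𝕜 hν f :=
  le_ciSup (hν.bddAbove f) x

theorem supSeminorm_le {S : Set Ω} {f : Ω →ᵇ 𝕜} {r : ℝ} (hr : 0 ≤ r) (h : ∀ x ∈ S, ‖f x‖ ≤ r) :
    supSeminorm 𝕜 S f ≤ r :=
  Real.iSup_le (fun x => h x x.2) hr

theorem le_supSeminorm {S : Set Ω} (f : Ω →ᵇ 𝕜) {x : Ω} (hx : x ∈ S) :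
    ‖f x‖ ≤ supSeminorm 𝕜 S f :=
  le_ciSup (bddAbove_norm S f) ⟨x, hx⟩

theorem withSeminorms_strictSeminorms :
    @WithSeminorms 𝕜 (Ω →ᵇ 𝕜) _ _ _ _ (strictSeminorms 𝕜 Ω) (strictTopology 𝕜 Ω) :=
  let _ := strictTopology 𝕜 Ω
  ⟨rfl⟩

theorem tendsto_nhds_strictTopology {ι : Type*} {l : Filter ι} {u : ι → Ω →ᵇ 𝕜} {f : Ω →ᵇ 𝕜} :
    Tendsto u l (@nhds _ (strictTopology 𝕜 Ω) f) ↔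
      ∀ ν : {ν : Ω → ℝ // IsWeight ν}, ∀ ε : ℝ, 0 < ε →
        ∀ᶠ i in l, strictSeminorms 𝕜 Ω ν (u i - f) < ε :=
  let _ := strictTopology 𝕜 Ω
  withSeminorms_strictSeminorms.tendsto_nhds u f

theorem tendsto_nhds_compactOpenTopology {ι : Type*} {l : Filter ι} {u : ι → Ω →ᵇ 𝕜}
    {f : Ω →ᵇ 𝕜} :
    Tendsto u l (@nhds _ (compactOpenTopology 𝕜 Ω) f) ↔
      ∀ K : Set Ω, IsCompact K → TendstoUniformlyOn (fun i x => u i x) f l K := by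
  rw [nhds_induced, tendsto_comap_iff, ContinuousMap.tendsto_iff_forall_isCompact_tendstoUniformlyOn]
  rfl

/-- `τ_co` is coarser than `β₀`. -/
theorem tendstoUniformlyOn_of_tendsto_strictTopology {ι : Type*} {l : Filter ι}
    {u : ι → Ω →ᵇ 𝕜} {f : Ω →ᵇ 𝕜} (h : Tendsto u l (@nhds _ (strictTopology 𝕜 Ω) f))
    {K : Set Ω} (hK : IsCompact K) : TendstoUniformlyOn (fun i x => u i x) f l K := by
  rw [Metric.tendstoUniformlyOn_iff]
  intro ε hε
  filter_upwards [tendsto_nhds_strictTopology.1 h ⟨_, isWeight_indicator hK⟩ ε hε] with i hi x hx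
  have := (le_weightSeminorm (isWeight_indicator hK) (u i - f) x).trans_lt hi
  rw [dist_comm, dist_eq_norm]
  simpa [hx] using this

/-- Equicontinuity from estimates on a generating family of seminorms. -/
theorem isEquicontinuous_of_forall_exists_le {X ι I : Type*} [AddCommGroup X] [Module 𝕜 X]
    {τ : TopologicalSpace X} {P : SeminormFamily 𝕜 X ι} (hP : WithSeminorms P)
    {T : I → X →ₗ[𝕜] X} (h : ∀ i, ∃ j, ∀ t x, P i (T t x) ≤ P j x) :
    IsEquicontinuous τ fun t x => T t x := by
  classical
  intro x U hU
  obtain ⟨s, r, hr, hs⟩ := (hP.mem_nhds_iff 0 U).1 hU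
  choose j hj using h
  refine ⟨_, (hP.mem_nhds_iff x _).2 ⟨s.image j, r, hr, subset_rfl⟩, fun t y hy => hs ?_⟩
  rw [Seminorm.ball_finset_sup_eq_iInter _ _ _ hr, mem_iInter₂] at hy ⊢
  intro i hi
  have := hy (j i) (Finset.mem_image_of_mem j hi)
  rw [Seminorm.mem_ball] at this ⊢
  rw [sub_zero, ← map_sub]
  exact (hj i t _).trans_lt this

end Seminorms

/-! ### `k_ℝ`-spaces -/

section KRSpace

variable {Ω : Type*} [TopologicalSpace Ω]

theorem IsKRSpace.continuous_of_continuousOn {𝕜 : Type*} [RCLike 𝕜] (hΩ : IsKRSpace Ω) {f : Ω → 𝕜}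
    (hf : ∀ K : Set Ω, IsCompact K → ContinuousOn f K) : Continuous f := by
  have hre : Continuous fun x => RCLike.re (f x) :=
    hΩ.2 _ fun K hK => RCLike.continuous_re.comp_continuousOn (hf K hK)
  have him : Continuous fun x => RCLike.im (f x) :=
    hΩ.2 _ fun K hK => RCLike.continuous_im.comp_continuousOn (hf K hK)
  have : f = fun x => (RCLike.re (f x) : 𝕜) + RCLike.im (f x) * RCLike.I :=
    funext fun x => (RCLike.re_add_im (f x)).symm
  rw [this]
  exact (RCLike.continuous_ofReal.comp hre).add
    ((RCLike.continuous_ofReal.comp him).mul continuous_const)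

/-- Real functions on the product of a locally compact space and a `k_ℝ`-space are continuous as
soon as they are continuous over the compact subsets of the second factor. -/
theorem IsKRSpace.continuous_prod {Y : Type*} [TopologicalSpace Y] [WeaklyLocallyCompactSpace Y]
    (hΩ : IsKRSpace Ω) {F : Y × Ω → ℝ}
    (hF : ∀ K : Set Ω, IsCompact K → ContinuousOn F (univ ×ˢ K)) : Continuous F := by
  rw [continuous_iff_continuousAt]
  rintro ⟨y₀, x₀⟩
  obtain ⟨I, hI, hIy⟩ := exists_compact_mem_nhds y₀
  have hF₀ : Continuous fun y => F (y, x₀) :=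
    (hF {x₀} isCompact_singleton).comp_continuous (by fun_prop) (by simp)
  -- Taking the supremum over the compact neighbourhood `I` reduces joint continuity to that of one
  -- function on `Ω`. On compact `K` it is continuous as a supremum over a compact parameter set,
  -- and the `k_ℝ` property does the rest.
  let g : Ω → ℝ := fun x => sSup ((fun y => |F (y, x) - F (y, x₀)|) '' I)
  have hsec : ∀ {K : Set Ω}, IsCompact K → Continuous fun p : K × Y => F (p.2, p.1) := fun hK =>
    (hF _ hK).comp_continuous (by fun_prop) (by simp)
  have hg : Continuous g := by
    refine hΩ.2 g fun K hK => continuousOn_iff_continuous_domRestrict.2 ?_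
    refine hI.continuous_sSup (f := fun (x : K) y => |F (y, x) - F (y, x₀)|) ?_
    exact ((hsec hK).sub (hF₀.comp continuous_snd)).abs
  have hg₀ : g x₀ = 0 := by
    have : (fun y => |F (y, x₀) - F (y, x₀)|) '' I = {0} := by
      have hne : I.Nonempty := ⟨y₀, mem_of_mem_nhds hIy⟩
      simpa using hne.image_const (0 : ℝ)
    simp only [g, this, csSup_singleton]
  have hle : ∀ y ∈ I, ∀ x, |F (y, x) - F (y, x₀)| ≤ g x := by
    intro y hy x
    refine le_csSup (hI.image ?_).bddAbove (mem_image_of_mem _ hy)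
    have hx : Continuous fun y => F (y, x) :=
      (hF {x} isCompact_singleton).comp_continuous (by fun_prop) (by simp)
    exact (hx.sub hF₀).abs
  have hlim : Tendsto (fun p : Y × Ω => F (p.1, x₀)) (𝓝 (y₀, x₀)) (𝓝 (F (y₀, x₀))) :=
    (hF₀.comp continuous_fst).tendsto (y₀, x₀)
  -- Near `y₀` the difference is dominated by `g`, which is continuous and vanishes at `x₀`.
  have hdiff : Tendsto (fun p : Y × Ω => F p - F (p.1, x₀)) (𝓝 (y₀, x₀)) (𝓝 0) := by
    refine squeeze_zero_norm' (a := fun p => g p.2) ?_ ?_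
    · filter_upwards [prod_mem_nhds hIy univ_mem] with p hp
      exact hle p.1 hp.1 p.2
    · simpa [hg₀, Function.comp_def] using (hg.comp continuous_snd).tendsto (y₀, x₀)
  simpa [ContinuousAt] using hdiff.add hlim

end KRSpace

/-- A map into a completely regular space is continuous if its compositions with all bounded
continuous functions are. -/
theorem continuous_of_forall_comp {Y Ω : Type*} [TopologicalSpace Y] [TopologicalSpace Ω]
    [CompletelyRegularSpace Ω] {π : Y → Ω} (h : ∀ f : Ω →ᵇ ℝ, Continuous fun y => f (π y)) :
    Continuous π := by
  rw [continuous_iff_continuousAt]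
  intro y
  rw [ContinuousAt, tendsto_nhds]
  intro U hU hy
  obtain ⟨f, hf, hf0, hf1⟩ := CompletelyRegularSpace.completely_regular (π y) Uᶜ hU.isClosed_compl
    (fun h => h hy)
  let g : Ω →ᵇ ℝ := BoundedContinuousFunction.ofNormedAddCommGroup (fun x => (f x : ℝ))
    (by fun_prop) 1 fun x => by
      rw [Real.norm_of_nonneg (f x).2.1]
      exact (f x).2.2
  -- Since `g` equals 1 off `U`, the condition `g < 1` forces a point into `U`.
  have hlt : g (π y) < 1 := by
    change (f (π y) : ℝ) < 1
    simp [hf0]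
  filter_upwards [(h g).continuousAt.eventually (gt_mem_nhds hlt)] with z hz
  by_contra hzU
  have : (f (π z) : ℝ) = 1 := by simp [hf1 hzU]
  exact hz.ne this

/-! ### The Koopman semigroup -/

section Semigroup

variable {𝕜 : Type*} [RCLike 𝕜] {Ω : Type*} [TopologicalSpace Ω] {φ : ℝ≥0 → Ω → Ω}

@[simp]
theorem koopman_apply (h : PreservesCb 𝕜 φ) (t : ℝ≥0) (f : Ω →ᵇ 𝕜) (x : Ω) :
    koopman h t f x = f (φ t x) := rfl

theorem norm_koopman_le (h : PreservesCb 𝕜 φ) (t : ℝ≥0) (f : Ω →ᵇ 𝕜) : ‖koopman h t f‖ ≤ ‖f‖ :=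
  (BoundedContinuousFunction.norm_le (norm_nonneg f)).2 fun x => f.norm_coe_le_norm (φ t x)

/-- Tube lemma: the jointly continuous distance vanishes on `{s} × K`, so by compactness of `K` it
is small on `K` for all times near `s`. -/
theorem tendstoUniformlyOn_koopman (h : PreservesCb 𝕜 φ)
    (hc : Continuous fun p : ℝ≥0 × Ω => φ p.1 p.2) (f : Ω →ᵇ 𝕜) (s : ℝ≥0) {K : Set Ω}
    (hK : IsCompact K) :
    TendstoUniformlyOn (fun t x => koopman h t f x) (koopman h s f) (𝓝 s) K := by
  rw [Metric.tendstoUniformlyOn_iff]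
  intro ε hε
  refine hK.eventually_forall_of_forall_eventually
    (P := fun t x => dist (f (φ s x)) (f (φ t x)) < ε) fun x _ => ?_
  have hcont : Continuous fun p : ℝ≥0 × Ω => dist (f (φ s p.2)) (f (φ p.1 p.2)) :=
    (f.continuous.comp (hc.comp (by fun_prop : Continuous fun p : ℝ≥0 × Ω => (s, p.2)))).dist
      (f.continuous.comp hc)
  exact hcont.continuousAt.eventually (gt_mem_nhds (by simpa using hε))

theorem isStronglyContinuous_koopman_compactOpenTopology (h : PreservesCb 𝕜 φ)
    (hc : Continuous fun p : ℝ≥0 × Ω => φ p.1 p.2) :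
    IsStronglyContinuous (compactOpenTopology 𝕜 Ω) (koopman h) := fun f =>
  (@continuous_iff_continuousAt _ _ _ (compactOpenTopology 𝕜 Ω) _).2 fun s =>
    tendsto_nhds_compactOpenTopology.2 fun _ hK => tendstoUniformlyOn_koopman h hc f s hK

theorem isStronglyContinuous_koopman_strictTopology (h : PreservesCb 𝕜 φ)
    (hc : Continuous fun p : ℝ≥0 × Ω => φ p.1 p.2) :
    IsStronglyContinuous (strictTopology 𝕜 Ω) (koopman h) := by
  refine fun f => (@continuous_iff_continuousAt _ _ _ (strictTopology 𝕜 Ω) _).2 fun s =>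
    tendsto_nhds_strictTopology.2 ?_
  rintro ⟨ν, hν⟩ ε hε
  obtain ⟨C, hC⟩ := hν.bounded
  have hC0 : 0 < max C 1 := by positivity
  have hf0 : 0 < 2 * ‖f‖ + 1 := by positivity
  -- The threshold is chosen so that, where `ν` lies below it, the crude bound `2 * ‖f‖` on the
  -- difference contributes at most `ε / 2`; on the remaining compact set uniform convergence is
  -- used.
  have hev := Metric.tendstoUniformlyOn_iff.1 (tendstoUniformlyOn_koopman h hc f s
    (hν.compact (ε / 2 / (2 * ‖f‖ + 1)) (by positivity))) (ε / 2 / max C 1) (by positivity)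
  filter_upwards [hev] with t ht
  refine (weightSeminorm_le hν (half_pos hε).le fun x => ?_).trans_lt (half_lt_self hε)
  rcases le_or_gt (ε / 2 / (2 * ‖f‖ + 1)) (ν x) with hx | hx
  · have h1 := ht x hx
    rw [dist_comm, dist_eq_norm] at h1
    calc ‖(koopman h t f - koopman h s f) x‖ * ν x
        ≤ (ε / 2 / max C 1) * max C 1 :=
          mul_le_mul h1.le ((hC x).trans (le_max_left _ _)) (hν.nonneg x) (by positivity)
      _ = ε / 2 := by field_simp
  · have h1 : ‖(koopman h t f - koopman h s f) x‖ ≤ 2 * ‖f‖ + 1 := by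
      have := norm_sub_le (f (φ t x)) (f (φ s x))
      have h2 := f.norm_coe_le_norm (φ t x)
      have h3 := f.norm_coe_le_norm (φ s x)
      change ‖f (φ t x) - f (φ s x)‖ ≤ _
      linarith
    calc ‖(koopman h t f - koopman h s f) x‖ * ν x
        ≤ (2 * ‖f‖ + 1) * (ε / 2 / (2 * ‖f‖ + 1)) :=
          mul_le_mul h1 hx.le (hν.nonneg x) hf0.le
      _ = ε / 2 := by field_simp

/-- For a continuous semiflow, `(w t • T_φ t)_{t ≥ 0}` satisfies the seminorm estimate of
`β₀`-equicontinuity for every weight `w` on `[0, ∞)`. -/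
theorem exists_mul_strictSeminorms_koopman_le [T2Space Ω] (h : PreservesCb 𝕜 φ)
    (hc : Continuous fun p : ℝ≥0 × Ω => φ p.1 p.2) {w : ℝ≥0 → ℝ} (hw : IsWeight w)
    (ν : {ν : Ω → ℝ // IsWeight ν}) :
    ∃ μ : {μ : Ω → ℝ // IsWeight μ}, ∀ t f,
      w t * strictSeminorms 𝕜 Ω ν (koopman h t f) ≤ strictSeminorms 𝕜 Ω μ f := by
  obtain ⟨μ, hμ, hle⟩ := (hw.prod ν.2).exists_le_comp hc
  refine ⟨⟨μ, hμ⟩, fun t f => ?_⟩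
  change w t * ⨆ x, ‖f (φ t x)‖ * ν.1 x ≤ weightSeminorm 𝕜 hμ f
  rw [Real.mul_iSup_of_nonneg (hw.nonneg t)]
  refine Real.iSup_le (fun x => ?_) (apply_nonneg _ _)
  calc w t * (‖f (φ t x)‖ * ν.1 x) = ‖f (φ t x)‖ * (w t * ν.1 x) := by ring
    _ ≤ ‖f (φ t x)‖ * μ (φ t x) := mul_le_mul_of_nonneg_left (hle (t, x)) (norm_nonneg _)
    _ ≤ weightSeminorm 𝕜 hμ f := le_weightSeminorm hμ f _

/-- For a continuous semiflow, `(w t • T_φ t)_{t ≥ 0}` satisfies the equitightness estimate for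
every weight `w` on `[0, ∞)`. -/
theorem exists_mul_compactSeminorms_koopman_le (h : PreservesCb 𝕜 φ)
    (hc : Continuous fun p : ℝ≥0 × Ω => φ p.1 p.2) {w : ℝ≥0 → ℝ} (hw : IsWeight w)
    {ε : ℝ} (hε : 0 < ε) (K : TopologicalSpace.Compacts Ω) :
    ∃ L : TopologicalSpace.Compacts Ω, ∃ C : ℝ, 0 ≤ C ∧ ∀ t f,
      w t * compactSeminorms 𝕜 Ω K (koopman h t f) ≤ C * compactSeminorms 𝕜 Ω L f + ε * ‖f‖ := by
  obtain ⟨C, hC⟩ := hw.bounded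
  have hC0 : 0 ≤ C := (hw.nonneg 0).trans (hC 0)
  -- Times with `ε ≤ w t` move `K` inside this compact image; all other times are absorbed by `ε *
  -- ‖f‖`.
  refine ⟨⟨_, ((hw.compact ε hε).prod K.isCompact).image hc⟩, C, hC0, fun t f => ?_⟩
  rcases le_or_gt ε (w t) with ht | ht
  · refine le_add_of_le_of_nonneg (mul_le_mul (hC t) ?_ (apply_nonneg _ _) hC0) (by positivity)
    exact supSeminorm_le (apply_nonneg _ _) fun x hx =>
      le_supSeminorm f ⟨(t, x), ⟨ht, hx⟩, rfl⟩
  · refine le_add_of_nonneg_of_le (mul_nonneg hC0 (apply_nonneg _ _))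
      (mul_le_mul ht.le ?_ (apply_nonneg _ _) hε.le)
    exact supSeminorm_le (norm_nonneg f) fun x _ => f.norm_coe_le_norm (φ t x)

theorem isLocallyEquicontinuous_koopman [T2Space Ω] (h : PreservesCb 𝕜 φ)
    (hc : Continuous fun p : ℝ≥0 × Ω => φ p.1 p.2) :
    IsLocallyEquicontinuous (strictTopology 𝕜 Ω) (koopman h) := by
  intro t₀
  refine isEquicontinuous_of_forall_exists_le (τ := strictTopology 𝕜 Ω)
    withSeminorms_strictSeminorms (T := fun t : Icc 0 t₀ => koopman h t) fun ν => ?_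
  obtain ⟨μ, hμ⟩ := exists_mul_strictSeminorms_koopman_le h hc
    (isWeight_indicator (isCompact_Icc (a := 0) (b := t₀))) ν
  exact ⟨μ, fun t f => by simpa using hμ t f⟩

theorem isLocallyEquitight_koopman (h : PreservesCb 𝕜 φ)
    (hc : Continuous fun p : ℝ≥0 × Ω => φ p.1 p.2) :
    IsLocallyEquitight (compactSeminorms 𝕜 Ω) (koopman h) := by
  intro t₀ ε hε K
  obtain ⟨L, C, hC, hL⟩ := exists_mul_compactSeminorms_koopman_le h hc
    (isWeight_indicator (isCompact_Icc (a := 0) (b := t₀))) hε K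
  exact ⟨L, C, hC, fun t f => by simpa using hL t f⟩

theorem apply_rescale_one {X : Type*} [AddCommGroup X] [Module 𝕜 X] (p : Seminorm 𝕜 X)
    (T : ℝ≥0 → X →ₗ[𝕜] X) (t : ℝ≥0) (x : X) :
    p (rescale 1 T t x) = Real.exp (-(t : ℝ)) * p (T t x) := by
  rw [rescale, LinearMap.smul_apply, map_smul_eq_mul, RCLike.norm_ofReal,
    abs_of_pos (Real.exp_pos _), neg_one_mul]

theorem isQuasiEquicontinuous_koopman [T2Space Ω] (h : PreservesCb 𝕜 φ)
    (hc : Continuous fun p : ℝ≥0 × Ω => φ p.1 p.2) :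
    IsQuasiEquicontinuous (strictTopology 𝕜 Ω) (koopman h) := by
  -- Any positive exponent would serve; all that matters is that the damping factor is a weight on
  -- `[0, ∞)`.
  refine ⟨1, isEquicontinuous_of_forall_exists_le (τ := strictTopology 𝕜 Ω)
    withSeminorms_strictSeminorms (T := rescale 1 (koopman h)) fun ν => ?_⟩
  obtain ⟨μ, hμ⟩ := exists_mul_strictSeminorms_koopman_le h hc isWeight_exp_neg ν
  exact ⟨μ, fun t f => (apply_rescale_one _ _ _ _).trans_le (hμ t f)⟩

theorem isQuasiEquitight_koopman (h : PreservesCb 𝕜 φ)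
    (hc : Continuous fun p : ℝ≥0 × Ω => φ p.1 p.2) :
    IsQuasiEquitight (compactSeminorms 𝕜 Ω) (koopman h) := by
  refine ⟨1, fun ε hε K => ?_⟩
  obtain ⟨L, C, hC, hL⟩ := exists_mul_compactSeminorms_koopman_le h hc isWeight_exp_neg hε K
  exact ⟨L, C, hC, fun t f => (apply_rescale_one _ _ _ _).trans_le (hL t f)⟩

theorem continuous_of_isStronglyContinuous_koopman [CompletelyRegularSpace Ω] (hΩ : IsKRSpace Ω)
    (h : PreservesCb 𝕜 φ) (hT : IsStronglyContinuous (strictTopology 𝕜 Ω) (koopman h)) :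
    Continuous fun p : ℝ≥0 × Ω => φ p.1 p.2 := by
  refine continuous_of_forall_comp fun f => hΩ.continuous_prod fun K hK => ?_
  -- Complete regularity is tested with real functions, whereas the semigroup acts on `𝕜`-valued
  -- ones.
  let g : Ω →ᵇ 𝕜 := BoundedContinuousFunction.ofNormedAddCommGroup (fun x => (f x : 𝕜))
    (RCLike.continuous_ofReal.comp f.continuous) ‖f‖ fun x => by
      rw [RCLike.norm_ofReal]
      exact f.norm_coe_le_norm x
  have hg : ContinuousOn (fun p : ℝ≥0 × Ω => g (φ p.1 p.2)) (univ ×ˢ K) := by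
    rintro ⟨s, x⟩ ⟨-, hx⟩
    have hlim := tendstoUniformlyOn_of_tendsto_strictTopology
      ((@continuous_iff_continuousAt _ _ _ (strictTopology 𝕜 Ω) _).1 (hT g) s) hK
    -- At the fixed time `s` continuity in `x` is part of `PreservesCb`; the change from `s` to
    -- nearby times is small uniformly on `K`.
    have h2 : Tendsto (fun p : ℝ≥0 × Ω => g (φ s p.2)) (𝓝[univ ×ˢ K] (s, x)) (𝓝 (g (φ s x))) :=
      (((h s g).comp continuous_snd).tendsto (s, x)).mono_left nhdsWithin_le_nhds
    have h1 : Tendsto (fun p : ℝ≥0 × Ω => dist (g (φ p.1 p.2)) (g (φ s p.2)))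
        (𝓝[univ ×ˢ K] (s, x)) (𝓝 0) := by
      rw [Metric.tendsto_nhds]
      intro ε hε
      have h3 := (continuous_fst.tendsto (s, x)).eventually
        (Metric.tendstoUniformlyOn_iff.1 hlim ε hε)
      filter_upwards [nhdsWithin_le_nhds h3, self_mem_nhdsWithin] with p hp hpK
      rw [Real.dist_0_eq_abs, abs_of_nonneg dist_nonneg, dist_comm]
      exact hp p.2 hpK.2
    exact (tendsto_iff_of_dist h1).2 h2
  have := RCLike.continuous_re.comp_continuousOn hg
  simpa [g, Function.comp_def] using this

/-! ### Bi-continuity -/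

variable (𝕜) in
theorem isBiContinuousTriple_compactOpenTopology (hΩ : IsKRSpace Ω) :
    IsBiContinuousTriple 𝕜 (compactOpenTopology 𝕜 Ω) where
  complete := inferInstance
  coarser := by
    refine continuous_iff_le_induced.1 (continuous_iff_continuousAt.2 fun f => ?_)
    rw [ContinuousAt, ContinuousMap.tendsto_iff_forall_isCompact_tendstoUniformlyOn]
    intro K _
    exact (BoundedContinuousFunction.tendsto_iff_tendstoUniformly.1 tendsto_id).tendstoUniformlyOn
  hausdorff := by
    let τ := compactOpenTopology 𝕜 Ω
    refine T2Space.of_injective_continuous (f := fun f : Ω →ᵇ 𝕜 => f.toContinuousMap)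
      (fun f g hfg => ?_) continuous_induced_dom
    ext x
    exact DFunLike.congr_fun hfg x
  locallyConvex :=
    @WithSeminorms.toPolynormableSpace _ _ _ _ _ _ (compactOpenTopology 𝕜 Ω) _
      (withSeminorms_compactSeminorms 𝕜 Ω)
  seqComplete := by
    rintro u ⟨C, hC⟩ hu
    have hcauchy : ∀ K : Set Ω, IsCompact K → UniformCauchySeqOn (fun n x => u n x) atTop K := by
      intro K hK
      rw [Metric.uniformCauchySeqOn_iff]
      intro ε hε
      obtain ⟨N, hN⟩ := hu ((compactSeminorms 𝕜 Ω ⟨K, hK⟩).ball 0 ε)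
        ((@WithSeminorms.mem_nhds_iff _ _ _ _ _ _ (compactOpenTopology 𝕜 Ω) _
          (withSeminorms_compactSeminorms 𝕜 Ω) 0 _).2 ⟨{⟨K, hK⟩}, ε, hε, by simp⟩)
      refine ⟨N, fun m hm n hn x hx => ?_⟩
      have := hN m hm n hn
      rw [Seminorm.mem_ball, sub_zero] at this
      rw [dist_eq_norm]
      exact (le_supSeminorm (u m - u n) hx).trans_lt this
    have hlim : ∀ x, ∃ z, Tendsto (fun n => u n x) atTop (𝓝 z) := fun x =>
      cauchySeq_tendsto_of_complete ((hcauchy {x} isCompact_singleton).cauchySeq rfl)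
    choose g hg using hlim
    have hunif : ∀ K : Set Ω, IsCompact K → TendstoUniformlyOn (fun n x => u n x) g atTop K :=
      fun K hK => (hcauchy K hK).tendstoUniformlyOn_of_tendsto fun x _ => hg x
    -- The limit is continuous on each compact set as a uniform limit there; the `k_ℝ` property
    -- makes it continuous on `Ω`.
    have hgc : Continuous g := hΩ.continuous_of_continuousOn fun K hK =>
      (hunif K hK).continuousOn (Frequently.of_forall fun n => (u n).continuous.continuousOn)
    exact ⟨BoundedContinuousFunction.ofNormedAddCommGroup g hgc C fun x =>
      le_of_tendsto (hg x).norm (.of_forall fun n => ((u n).norm_coe_le_norm x).trans (hC n)),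
      tendsto_nhds_compactOpenTopology.2 hunif⟩
  norming f := by
    let τ := compactOpenTopology 𝕜 Ω
    refine ⟨?_, fun b hb => ?_⟩
    · rintro _ ⟨y, -, hy, rfl⟩
      exact hy f
    -- The zero functional gives `0 ≤ b` even when `Ω` is empty. Point evaluations are then enough
    -- to attain the sup norm as a supremum.
    · have hb0 : 0 ≤ b := hb ⟨0, @continuous_const _ _ τ _ 0, fun z => by simp, by simp⟩
      refine (BoundedContinuousFunction.norm_le hb0).2 fun x => hb
        ⟨{ toFun := fun g => g x, map_add' := fun _ _ => rfl, map_smul' := fun _ _ => rfl },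
          ?_, fun z => z.norm_coe_le_norm x, rfl⟩
      exact (continuous_eval_const (F := C(Ω, 𝕜)) x).comp continuous_induced_dom

theorem isBiContinuousSemigroup_koopman (hΩ : IsKRSpace Ω) (hφ : IsSemiflow φ)
    (h : PreservesCb 𝕜 φ) (hc : Continuous fun p : ℝ≥0 × Ω => φ p.1 p.2) :
    IsBiContinuousSemigroup (compactOpenTopology 𝕜 Ω) (koopman h) where
  triple := isBiContinuousTriple_compactOpenTopology 𝕜 hΩ
  bounded t := ⟨1, fun f => by simpa using norm_koopman_le h t f⟩
  map_zero := by
    ext f x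
    simp [hφ.map_zero]
  map_add t s := by
    ext f x
    -- Composition reverses the order of the flow maps, which commutativity of time addition
    -- repairs.
    simp [add_comm t s, ← hφ.map_add]
  stronglyContinuous := isStronglyContinuous_koopman_compactOpenTopology h hc
  expBounded := ⟨1, le_rfl, 0, fun t f => by simpa using norm_koopman_le h t f⟩
  biEquicontinuous u f _ hu t₀ U hU := by
    obtain ⟨s, r, hr, hs⟩ := (@WithSeminorms.mem_nhds_iff _ _ _ _ _ _ (compactOpenTopology 𝕜 Ω) _
      (withSeminorms_compactSeminorms 𝕜 Ω) 0 U).1 hU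
    rw [Seminorm.ball_finset_sup_eq_iInter _ _ _ hr] at hs
    have hev : ∀ K ∈ s, ∀ᶠ n in atTop, ∀ t ≤ t₀,
        compactSeminorms 𝕜 Ω K (koopman h t (u n - f)) < r := by
      intro K _
      -- Up to time `t₀` the flow keeps `K` inside one compact set, and uniform convergence there is
      -- uniform in `t`.
      have hL := (((isCompact_Icc (a := 0) (b := t₀)).prod K.isCompact).image hc)
      filter_upwards [Metric.tendstoUniformlyOn_iff.1 (tendsto_nhds_compactOpenTopology.1 hu _ hL)
        (r / 2) (half_pos hr)] with n hn t ht
      refine (supSeminorm_le (half_pos hr).le fun x hx => ?_).trans_lt (half_lt_self hr)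
      have := hn (φ t x) ⟨(t, x), ⟨⟨zero_le, ht⟩, hx⟩, rfl⟩
      rw [dist_comm, dist_eq_norm] at this
      exact this.le
    filter_upwards [(Finset.eventually_all s).2 hev] with n hn t ht
    refine hs (mem_iInter₂.2 fun K hK => ?_)
    rw [Seminorm.mem_ball, sub_zero]
    exact hn K hK t ht

end Semigroup

end Koopman

theorem corollary4p3 {𝕜 : Type*} [RCLike 𝕜] {Ω : Type*} [TopologicalSpace Ω] [T2Space Ω]
    [CompletelyRegularSpace Ω] (φ : ℝ≥0 → Ω → Ω) (hφ : Koopman.IsSemiflow φ) :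
    -- (a)
    (∀ hc : Continuous fun p : ℝ≥0 × Ω => φ p.1 p.2,
      Koopman.IsStronglyContinuous (Koopman.strictTopology 𝕜 Ω)
        (Koopman.koopman (Koopman.preservesCb_of_continuous 𝕜 hc)) ∧
      Koopman.IsLocallyEquicontinuous (Koopman.strictTopology 𝕜 Ω)
        (Koopman.koopman (Koopman.preservesCb_of_continuous 𝕜 hc)) ∧
      Koopman.IsLocallyEquitight (Koopman.compactSeminorms 𝕜 Ω)
        (Koopman.koopman (Koopman.preservesCb_of_continuous 𝕜 hc))) ∧
    -- (b)
    (Koopman.IsKRSpace Ω → ∀ h : Koopman.PreservesCb 𝕜 φ,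
      Koopman.IsStronglyContinuous (Koopman.strictTopology 𝕜 Ω) (Koopman.koopman h) →
      Continuous fun p : ℝ≥0 × Ω => φ p.1 p.2) ∧
    -- (c)
    (Koopman.IsKRSpace Ω → ∀ hc : Continuous fun p : ℝ≥0 × Ω => φ p.1 p.2,
      Koopman.IsBiContinuousSemigroup (Koopman.compactOpenTopology 𝕜 Ω)
        (Koopman.koopman (Koopman.preservesCb_of_continuous 𝕜 hc))) ∧
    -- (d)
    ((Koopman.IsHemicompact Ω ∧ Koopman.IsKRSpace Ω) ∨ PolishSpace Ω →
      ∀ hc : Continuous fun p : ℝ≥0 × Ω => φ p.1 p.2,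
      Koopman.IsQuasiEquicontinuous (Koopman.strictTopology 𝕜 Ω)
        (Koopman.koopman (Koopman.preservesCb_of_continuous 𝕜 hc)) ∧
      Koopman.IsQuasiEquitight (Koopman.compactSeminorms 𝕜 Ω)
        (Koopman.koopman (Koopman.preservesCb_of_continuous 𝕜 hc))) := by
  refine ⟨fun hc => ⟨Koopman.isStronglyContinuous_koopman_strictTopology _ hc,
    Koopman.isLocallyEquicontinuous_koopman _ hc, Koopman.isLocallyEquitight_koopman _ hc⟩,
    fun hΩ h hT => Koopman.continuous_of_isStronglyContinuous_koopman hΩ h hT,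
    fun hΩ hc => Koopman.isBiContinuousSemigroup_koopman hΩ hφ _ hc,
    fun _ hc => ⟨Koopman.isQuasiEquicontinuous_koopman _ hc,
      Koopman.isQuasiEquitight_koopman _ hc⟩⟩
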